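/- Let $d\ge 1$, let $X$ be a metric space, let $\phi=(\phi_{\mathbf t})_{\mathbf t\in\mathbb R^d}$ be a (jointly) continuous action of $\mathbb R^d$ on $X$, and let $\mu$ be a finite $\phi$-invariant Borel measure on $X$. The restricted action $\phi^{(\mathbf 1)}$ is the $\mathbb Z^d$-action $\phi^{(\mathbf 1)}_{\mathbf n}=\phi_{\mathbf n}$, $\mathbf n\in\mathbb Z^d$ (the time-$1$ map if $d=1$). Write $\langle f,g\rangle=\int_X f\,\overline g\,d\mu$ and $L^2_0=\{f\in L^2(X,\mu;\mathbb C):\int_X f\,d\mu=0\}$, and for $f,g\in L^2_0$ and $T>0$ put $$\alpha^{\phi}_{f,g}(T)=\frac1{(2T)^d}\int_{[-T,T]^d}|\langle f,g\circ\phi_{\mathbf t}\rangle|\,d\mathbf t,\qquad \alpha^{\phi^{(\mathbf 1)}}_{f,g}(T)=\frac1{(2T)^d}\sum_{\mathbf n\in\mathbb Z^d\cap[-T,T]^d}|\langle f,g\circ\phi_{\mathbf n}\rangle|.$$ An action $\psi\in\{\phi,\phi^{(\mathbf 1)}\}$ is called weak mixing if $\alpha^{\psi}_{f,g}(T)\to0$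 as $T\to\infty$ for all $f,g\in L^2_0$. Let $\mathcal B$ be an algebra (possibly without unit) of functions $X\to\mathbb C$ that belong to $L^1\cap L^2$, with pointwise operations, equipped with a complete norm $\|\cdot\|_{\mathcal B}$ for which multiplication is bounded. The action $\psi$ is called polynomially weak mixing (in $\mathcal B$) if there are $\delta>0$ and $C$ such that $\alpha^{\psi}_{f,g}(T)\le C\|f\|_{\mathcal B}\|g\|_{\mathcal B}T^{-\delta}$ for all $f,g\in\mathcal B\cap L^2_0$ and all $T\ge1$. Condition (N) means: (N1) there are $\rho>0$ and $C$ such that every $f\in\mathcal B$ is a bounded $\rho$-Hölder function with $\|f\|_{C^\rho}\le C\|f\|_{\mathcal B}$, where $\|f\|_{C^\rho}=\sup_x|f(x)|+\sup_{x\ne y}|f(x)-f(y)|\,d(x,y)^{-\rho}$; (N2) there are $\mathcal K>0$ and $C$ such that $f\circ\phi_{\mathbf t}\in\mathcal B$ and $\|f\circ\phi_{\mathbf t}\|_{\mathcal B}\le C\|f\|_{\mathcal B}(1+|\mathbf t|)^{\mathcal K}$ for all $f\in\mathcal B$ and $\mathbf t\in\mathbb R^d$. The action $\phi$ is called Hölder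 continuous if there are $\rho'>0$ and $C$ such that $d(\phi_{\mathbf s}(x),\phi_{\mathbf t}(x))\le C|\mathbf s-\mathbf t|^{\rho'}$ for all $x\in X$ and all $\mathbf s,\mathbf t\in\mathbb R^d$ with $|\mathbf s-\mathbf t|\le1$. Here $|\cdot|$ is the maximum norm on $\mathbb R^d$. Theorem. The action $\phi$ is weak mixing if and only if $\phi^{(\mathbf 1)}$ is weak mixing. Furthermore, if $\phi$ is Hölder continuous and condition (N) holds, then $\phi$ is polynomially weak mixing if and only if $\phi^{(\mathbf 1)}$ is polynomially weak mixing. -/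

import Mathlib

open MeasureTheory Filter Topology
open scoped NNReal ENNReal

noncomputable section

namespace WeakMixing

variable {X : Type*} {d : ℕ}

/-- The restriction of a continuous action of `ℝ^d` to `ℤ^d` (the time-1 map if `d = 1`). -/
def restrictedAction [TopologicalSpace X] (φ : Flow (Fin d → ℝ) X) : Flow (Fin d → ℤ) X where
  toFun n x := φ (fun i => (n i : ℝ)) x
  cont' := by
    have h : Continuous fun p : (Fin d → ℤ) × X => fun i => ((p.1 i : ℤ) : ℝ) :=
      continuous_pi fun i =>
        continuous_of_discreteTopology.comp ((continuous_apply i).comp continuous_fst)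
    exact φ.continuous h continuous_snd
  map_add' m n x := by
    rw [← φ.map_add]
    congr 1
    funext i
    simp
  map_zero' x := by
    have h : (fun i : Fin d => (((0 : Fin d → ℤ) i : ℤ) : ℝ)) = 0 := by
      funext i
      simp
    rw [h]
    exact φ.map_zero_apply x

/-- The measure `μ` is invariant under every map of the action `φ`. -/
def IsInvariantMeasure {G : Type*} [TopologicalSpace G] [AddGroup G] [TopologicalSpace X]
    [MeasurableSpace X] (φ : Flow G X) (μ : Measure X) : Prop :=
  ∀ t, MeasurePreserving (φ t) μ μ

/-- `f ∈ L²₀(μ)`: `f` is square integrable and has mean zero. -/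
def MemL2Zero [MeasurableSpace X] (μ : Measure X) (f : X → ℂ) : Prop :=
  MemLp f 2 μ ∧ ∫ x, f x ∂μ = 0

/-- The correlation `⟨f, g ∘ φ_t⟩ = ∫ f(x) conj(g(φ_t x)) dμ(x)`. -/
def correlation {G : Type*} [TopologicalSpace G] [AddGroup G] [TopologicalSpace X]
    [MeasurableSpace X] (φ : Flow G X) (μ : Measure X) (f g : X → ℂ) (t : G) : ℂ :=
  ∫ x, f x * (starRingEnd ℂ) (g (φ t x)) ∂μ

/-- The rate `α_{f,g}(T) = (2T)^{-d} ∫_{[-T,T]^d} |⟨f, g ∘ φ_t⟩| dt` of an `ℝ^d`-action. -/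
def alphaReal [TopologicalSpace X] [MeasurableSpace X] (φ : Flow (Fin d → ℝ) X) (μ : Measure X)
    (f g : X → ℂ) (T : ℝ) : ℝ :=
  ((2 * T) ^ d)⁻¹ * ∫ t in Set.Icc (fun _ : Fin d => -T) (fun _ => T), ‖correlation φ μ f g t‖

/-- The points of `ℤ^d ∩ [-T,T]^d`. -/
def intBox (d : ℕ) (T : ℝ) : Finset (Fin d → ℤ) :=
  Fintype.piFinset fun _ => Finset.Icc ⌈-T⌉ ⌊T⌋

/-- The rate `α_{f,g}(T) = (2T)^{-d} ∑_{n ∈ ℤ^d ∩ [-T,T]^d} |⟨f, g ∘ φ_n⟩|` of a `ℤ^d`-action. -/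
def alphaInt [TopologicalSpace X] [MeasurableSpace X] (φ : Flow (Fin d → ℤ) X) (μ : Measure X)
    (f g : X → ℂ) (T : ℝ) : ℝ :=
  ((2 * T) ^ d)⁻¹ * ∑ n ∈ intBox d T, ‖correlation φ μ f g n‖

/-- An `ℝ^d`-action is weak mixing with respect to `μ`. -/
def IsWeakMixingReal [TopologicalSpace X] [MeasurableSpace X] (φ : Flow (Fin d → ℝ) X)
    (μ : Measure X) : Prop :=
  ∀ f g : X → ℂ, MemL2Zero μ f → MemL2Zero μ g →
    Tendsto (fun T : ℝ => alphaReal φ μ f g T) atTop (𝓝 0)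

/-- A `ℤ^d`-action is weak mixing with respect to `μ`. -/
def IsWeakMixingInt [TopologicalSpace X] [MeasurableSpace X] (φ : Flow (Fin d → ℤ) X)
    (μ : Measure X) : Prop :=
  ∀ f g : X → ℂ, MemL2Zero μ f → MemL2Zero μ g →
    Tendsto (fun T : ℝ => alphaInt φ μ f g T) atTop (𝓝 0)

/-- An algebra of functions contained in `L¹(μ) ∩ L²(μ)`, closed under pointwise multiplication
(possibly without unit), with a complete norm for which multiplication is bounded. -/
structure BanachFunctionAlgebra [MeasurableSpace X] (μ : Measure X) where
  /-- The functions that belong to the algebra. -/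
  carrier : NonUnitalSubalgebra ℂ (X → ℂ)
  memLp_one : ∀ f ∈ carrier, MemLp f 1 μ
  memLp_two : ∀ f ∈ carrier, MemLp f 2 μ
  /-- The norm of the algebra. -/
  normB : Seminorm ℂ carrier
  eq_zero_of_normB : ∀ f : carrier, normB f = 0 → f = 0
  normB_mul_le : ∃ M : ℝ, ∀ f g : carrier, normB (f * g) ≤ M * normB f * normB g
  complete : ∀ u : ℕ → carrier,
    (∀ ε > 0, ∃ N, ∀ m ≥ N, ∀ n ≥ N, normB (u m - u n) < ε) →
      ∃ f : carrier, Tendsto (fun n => normB (u n - f)) atTop (𝓝 0)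

/-- The norm `sup |f| + [f]_ρ` of the space `C^ρ` of bounded `ρ`-Hölder functions, as an extended
nonnegative number (it is infinite exactly if `f` is not in `C^ρ`). -/
def holderSpaceNorm [MetricSpace X] (ρ : ℝ≥0) (f : X → ℂ) : ℝ≥0∞ :=
  (⨆ x, ‖f x‖ₑ) + eHolderNorm ρ f

/-- Condition (N1): for some `ρ > 0` the algebra lies in `C^ρ`, with a bounded inclusion. -/
def ConditionN1 [MetricSpace X] [MeasurableSpace X] {μ : Measure X}
    (B : BanachFunctionAlgebra μ) : Prop :=
  ∃ ρ : ℝ≥0, 0 < ρ ∧ ∃ C : ℝ, ∀ f : B.carrier,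
    holderSpaceNorm ρ (f : X → ℂ) ≤ ENNReal.ofReal (C * B.normB f)

/-- Condition (N2): the action preserves the algebra and its norm grows at most polynomially
along the action. -/
def ConditionN2 [TopologicalSpace X] [MeasurableSpace X] {μ : Measure X}
    (φ : Flow (Fin d → ℝ) X) (B : BanachFunctionAlgebra μ) : Prop :=
  ∃ K : ℝ, 0 < K ∧ ∃ C : ℝ, ∀ (t : Fin d → ℝ) (f : B.carrier),
    ∃ h : (fun x => (f : X → ℂ) (φ t x)) ∈ B.carrier,
      B.normB ⟨fun x => (f : X → ℂ) (φ t x), h⟩ ≤ C * B.normB f * (1 + ‖t‖) ^ K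

/-- Condition (N). -/
def ConditionN [MetricSpace X] [MeasurableSpace X] {μ : Measure X}
    (φ : Flow (Fin d → ℝ) X) (B : BanachFunctionAlgebra μ) : Prop :=
  ConditionN1 B ∧ ConditionN2 φ B

/-- The action is Hölder continuous in time, uniformly over the space. -/
def IsHolderAction [MetricSpace X] (φ : Flow (Fin d → ℝ) X) : Prop :=
  ∃ ρ : ℝ, 0 < ρ ∧ ∃ C : ℝ, ∀ (s t : Fin d → ℝ) (x : X), dist s t ≤ 1 →
    dist (φ s x) (φ t x) ≤ C * dist s t ^ ρ

/-- An `ℝ^d`-action is polynomially weak mixing for the algebra `B`. -/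
def IsPolyWeakMixingReal [TopologicalSpace X] [MeasurableSpace X] {μ : Measure X}
    (φ : Flow (Fin d → ℝ) X) (B : BanachFunctionAlgebra μ) : Prop :=
  ∃ δ : ℝ, 0 < δ ∧ ∃ C : ℝ, ∀ f g : B.carrier,
    MemL2Zero μ (f : X → ℂ) → MemL2Zero μ (g : X → ℂ) → ∀ T : ℝ, 1 ≤ T →
      alphaReal φ μ f g T ≤ C * B.normB f * B.normB g * T ^ (-δ)

/-- A `ℤ^d`-action is polynomially weak mixing for the algebra `B`. -/
def IsPolyWeakMixingInt [TopologicalSpace X] [MeasurableSpace X] {μ : Measure X}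
    (φ : Flow (Fin d → ℤ) X) (B : BanachFunctionAlgebra μ) : Prop :=
  ∃ δ : ℝ, 0 < δ ∧ ∃ C : ℝ, ∀ f g : B.carrier,
    MemL2Zero μ (f : X → ℂ) → MemL2Zero μ (g : X → ℂ) → ∀ T : ℝ, 1 ≤ T →
      alphaInt φ μ f g T ≤ C * B.normB f * B.normB g * T ^ (-δ)

end WeakMixing

end

/-!
Everything rests on the correlation `ψ(t) = ⟨f, g ∘ φ_t⟩`. By invariance of the measure and the
Cauchy-Schwarz inequality, `|ψ(s + t) - ψ(t)| ≤ ‖f‖₂ ‖g ∘ φ_s - g‖₂` for all `t`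
(`norm_correlation_add_sub_le`), and the right-hand side tends to zero with `s`
(`tendsto_lpNorm_comp_flow_sub`). Hence `ψ` is uniformly continuous.

From `ℤ^d` to `ℝ^d`: splitting `ℝ^d` into the unit cubes `n + [0, 1)^d` and using
`ψ(s + n) = ⟨f, (g ∘ φ_s) ∘ φ_n⟩`, the average of `|ψ|` over a box is bounded by the integral over
`s ∈ [0, 1)^d` of the discrete averages for the pair `f, g ∘ φ_s`
(`alphaReal_le_setIntegral_alphaInt`). This tends to zero by dominated convergence; in the
polynomial case condition (N2) bounds the norm of `g ∘ φ_s`, uniformly for `s` in the unit cube.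

From `ℝ^d` to `ℤ^d`: for `0 < ε ≤ 1` the cubes `n + [0, ε)^d` are disjoint, and `|ψ(n)|` exceeds the
mean of `|ψ|` over such a cube by at most the oscillation of `ψ`. The discrete average is therefore
at most a constant times `ε⁻ᵈ` times the continuous average, plus a constant times
`‖f‖₂ sup_s ‖g ∘ φ_s - g‖₂`, the supremum over `s ∈ [0, ε)^d` (`alphaInt_le_alphaReal_add`). For
weak mixing, `T` tends to infinity and then `ε` to zero. In the polynomial case, condition (N1) and
the Hölder continuity of the action make the oscillation `O(ε ^ r)` for some `r > 0`
(`lpNorm_comp_flow_sub_le`), and `ε` is a small negative power of `T`.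
-/

namespace WeakMixing

variable {X : Type*} {d : ℕ}

/-! ### Correlations in `L²` -/

section Correlation

section Pairing

variable [MeasurableSpace X] {μ : Measure X} {f g : X → ℂ}

theorem norm_integral_mul_conj_le (hf : MemLp f 2 μ) (hg : MemLp g 2 μ) :
    ‖∫ x, f x * (starRingEnd ℂ) (g x) ∂μ‖ ≤ lpNorm f 2 μ * lpNorm g 2 μ := by
  have h := norm_inner_le_norm (𝕜 := ℂ) (hg.toLp g) (hf.toLp f)
  rw [L2.inner_def, Lp.norm_toLp, Lp.norm_toLp, toReal_eLpNorm hf.1, toReal_eLpNorm hg.1,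
    mul_comm] at h
  refine le_of_eq_of_le ?_ h
  congr 1
  refine integral_congr_ae ?_
  filter_upwards [hf.coeFn_toLp, hg.coeFn_toLp] with x hx hy
  simp [hx, hy]

theorem lpNorm_comp_of_measurePreserving {e : X → X} (he : MeasurePreserving e μ μ)
    (hg : MemLp g 2 μ) : lpNorm (fun x => g (e x)) 2 μ = lpNorm g 2 μ := by
  change lpNorm (g ∘ e) 2 μ = _
  rw [← toReal_eLpNorm hg.1, ← toReal_eLpNorm (hg.1.comp_measurePreserving he)]
  exact congrArg _ (eLpNorm_comp_measurePreserving hg.1 he)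

theorem integrable_mul_conj (hf : MemLp f 2 μ) (hg : MemLp g 2 μ) :
    Integrable (fun x => f x * (starRingEnd ℂ) (g x)) μ :=
  hf.integrable_mul hg.star

end Pairing

variable {G : Type*} [TopologicalSpace G] [AddGroup G] [TopologicalSpace X] [MeasurableSpace X]
  {φ : Flow G X} {μ : Measure X} {f g h : X → ℂ}

theorem correlation_comp (s t : G) :
    correlation φ μ f (fun x => g (φ s x)) t = correlation φ μ f g (s + t) := by
  simp only [correlation, φ.map_add]

theorem IsInvariantMeasure.memLp_comp (hμ : IsInvariantMeasure φ μ) (hg : MemLp g 2 μ) (s : G) :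
    MemLp (fun x => g (φ s x)) 2 μ :=
  hg.comp_measurePreserving (hμ s)

theorem MemL2Zero.comp_flow (hμ : IsInvariantMeasure φ μ) (hg : MemL2Zero μ g) (s : G) :
    MemL2Zero μ (fun x => g (φ s x)) := by
  refine ⟨hμ.memLp_comp hg.1 s, ?_⟩
  have h := hg.1.1
  rw [← (hμ s).map_eq] at h
  rw [← integral_map (hμ s).aemeasurable h, (hμ s).map_eq]
  exact hg.2

theorem norm_correlation_le (hμ : IsInvariantMeasure φ μ) (hf : MemLp f 2 μ) (hg : MemLp g 2 μ)
    (t : G) : ‖correlation φ μ f g t‖ ≤ lpNorm f 2 μ * lpNorm g 2 μ := by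
  rw [← lpNorm_comp_of_measurePreserving (hμ t) hg]
  exact norm_integral_mul_conj_le hf (hμ.memLp_comp hg t)

theorem correlation_sub_right (hμ : IsInvariantMeasure φ μ) (hf : MemLp f 2 μ)
    (hg : MemLp g 2 μ) (hh : MemLp h 2 μ) (t : G) :
    correlation φ μ f (fun x => g x - h x) t = correlation φ μ f g t - correlation φ μ f h t := by
  rw [correlation, correlation, correlation,
    ← integral_sub (integrable_mul_conj hf (hμ.memLp_comp hg t))
      (integrable_mul_conj hf (hμ.memLp_comp hh t))]
  simp [mul_sub]

/-- The modulus of continuity of a correlation is controlled, uniformly in the time, by that of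
the translation action in `L²`. -/
theorem norm_correlation_add_sub_le (hμ : IsInvariantMeasure φ μ) (hf : MemLp f 2 μ)
    (hg : MemLp g 2 μ) (s t : G) :
    ‖correlation φ μ f g (s + t) - correlation φ μ f g t‖ ≤
      lpNorm f 2 μ * lpNorm ((fun x => g (φ s x)) - g) 2 μ := by
  have hs := hμ.memLp_comp hg s
  rw [← correlation_comp, ← correlation_sub_right hμ hf hs hg]
  exact norm_correlation_le hμ hf (hs.sub hg) t

end Correlation

section Continuity

variable {G : Type*} [TopologicalSpace G] [AddGroup G] [FirstCountableTopology G]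
  [MetricSpace X] [MeasurableSpace X] [BorelSpace X]
  {φ : Flow G X} {μ : Measure X} [IsFiniteMeasure μ] {f g : X → ℂ}

theorem tendsto_eLpNorm_comp_flow_sub_of_bounded (g : BoundedContinuousFunction X ℂ) :
    Tendsto (fun s => eLpNorm ((fun x => g (φ s x)) - ⇑g) 2 μ) (𝓝 0) (𝓝 0) := by
  have key : Tendsto (fun s => ∫⁻ x, ‖g (φ s x) - g x‖ₑ ^ (2 : ℝ) ∂μ) (𝓝 0)
      (𝓝 (∫⁻ _, 0 ∂μ)) := by
    refine tendsto_lintegral_filter_of_dominated_convergence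
      (fun _ => ENNReal.ofReal (2 * ‖g‖) ^ (2 : ℝ)) ?_ ?_ ?_ ?_
    · refine Eventually.of_forall fun s => ?_
      have : Continuous fun x => g (φ s x) - g x :=
        (g.continuous.comp (φ.continuous continuous_const continuous_id)).sub g.continuous
      exact this.measurable.enorm.pow_const _
    · refine Eventually.of_forall fun s => Eventually.of_forall fun x => ?_
      gcongr
      rw [← ofReal_norm]
      gcongr
      calc ‖g (φ s x) - g x‖ ≤ ‖g (φ s x)‖ + ‖g x‖ := norm_sub_le _ _
        _ ≤ 2 * ‖g‖ := by linarith [g.norm_coe_le_norm (φ s x), g.norm_coe_le_norm x]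
    · rw [lintegral_const]
      exact ENNReal.mul_ne_top (ENNReal.rpow_ne_top_of_nonneg (by norm_num) ENNReal.ofReal_ne_top)
        (measure_ne_top _ _)
    · refine Eventually.of_forall fun x => ?_
      have hc : Continuous fun s => ‖g (φ s x) - g x‖ₑ ^ (2 : ℝ) :=
        ENNReal.continuous_rpow_const.comp (continuous_enorm.comp
          ((g.continuous.comp (φ.continuous continuous_id continuous_const)).sub
            continuous_const))
      simpa using hc.tendsto 0
  have h2 := (ENNReal.continuous_rpow_const (y := 1 / (2 : ℝ))).tendsto _ |>.comp key
  simp only [lintegral_zero] at h2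
  rw [ENNReal.zero_rpow_of_pos (by norm_num)] at h2
  refine h2.congr fun s => ?_
  rw [eLpNorm_eq_lintegral_rpow_enorm_toReal (by norm_num) (by norm_num)]
  simp

/-- Strong continuity of the translation action on `L²`. No separability of `X` is needed: bounded
continuous functions are dense in `L²`, and the translations are isometries. -/
theorem tendsto_lpNorm_comp_flow_sub (hμ : IsInvariantMeasure φ μ) (hg : MemLp g 2 μ) :
    Tendsto (fun s => lpNorm ((fun x => g (φ s x)) - g) 2 μ) (𝓝 0) (𝓝 0) := by
  have key : Tendsto (fun s => eLpNorm ((fun x => g (φ s x)) - g) 2 μ) (𝓝 0) (𝓝 0) := by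
    rw [ENNReal.tendsto_nhds_zero]
    intro ε hε
    obtain ⟨u, hu, hu2, hu0⟩ : ∃ u : X → ℂ, eLpNorm (g - u) 2 μ ≤ ε / 3 ∧ MemLp u 2 μ ∧
        Tendsto (fun s => eLpNorm ((fun x => u (φ s x)) - u) 2 μ) (𝓝 0) (𝓝 0) := by
      obtain ⟨k, hk, hk2⟩ := hg.exists_boundedContinuous_eLpNorm_sub_le (by norm_num)
        (ε := ε / 3) (by simp [hε.ne'])
      exact ⟨k, hk, hk2, tendsto_eLpNorm_comp_flow_sub_of_bounded k⟩
    have h3 : 0 < ε / 3 := ENNReal.div_pos hε.ne' (by norm_num)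
    filter_upwards [ENNReal.tendsto_nhds_zero.1 hu0 _ h3] with s hs
    have hgu : MemLp (fun x => g (φ s x) - u (φ s x)) 2 μ := hμ.memLp_comp (hg.sub hu2) s
    have hus : MemLp ((fun x => u (φ s x)) - u) 2 μ := (hμ.memLp_comp hu2 s).sub hu2
    have e : (fun x => g (φ s x)) - g =
        (fun x => g (φ s x) - u (φ s x)) + (((fun x => u (φ s x)) - u) - (g - u)) := by
      funext x
      simp
    have h1 : eLpNorm (fun x => g (φ s x) - u (φ s x)) 2 μ ≤ ε / 3 :=
      (eLpNorm_comp_measurePreserving (hg.sub hu2).1 (hμ s)).trans_le hu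
    calc eLpNorm ((fun x => g (φ s x)) - g) 2 μ
        ≤ eLpNorm (fun x => g (φ s x) - u (φ s x)) 2 μ +
          eLpNorm (((fun x => u (φ s x)) - u) - (g - u)) 2 μ := by
          rw [e]
          exact eLpNorm_add_le hgu.1 (hus.sub (hg.sub hu2)).1 (by norm_num)
      _ ≤ eLpNorm (fun x => g (φ s x) - u (φ s x)) 2 μ +
          (eLpNorm ((fun x => u (φ s x)) - u) 2 μ + eLpNorm (g - u) 2 μ) := by
          gcongr
          exact eLpNorm_sub_le hus.1 (hg.sub hu2).1 (by norm_num)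
      _ ≤ ε / 3 + (ε / 3 + ε / 3) := by gcongr
      _ = ε := by rw [← add_assoc, ENNReal.add_thirds]
  have := (ENNReal.tendsto_toReal ENNReal.zero_ne_top).comp key
  refine this.congr fun s => ?_
  exact toReal_eLpNorm ((hμ.memLp_comp hg s).sub hg).1

theorem continuous_correlation [ContinuousSub G] (hμ : IsInvariantMeasure φ μ) (hf : MemLp f 2 μ)
    (hg : MemLp g 2 μ) : Continuous (correlation φ μ f g) := by
  refine continuous_iff_continuousAt.2 fun t => ?_
  rw [ContinuousAt, tendsto_iff_norm_sub_tendsto_zero]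
  have h0 : Tendsto (fun s : G => s - t) (𝓝 t) (𝓝 0) := by
    have : Continuous fun s : G => s - t := continuous_id.sub continuous_const
    simpa using this.tendsto t
  have h1 := ((tendsto_lpNorm_comp_flow_sub hμ hg).comp h0).const_mul (lpNorm f 2 μ)
  rw [mul_zero] at h1
  refine squeeze_zero (fun _ => norm_nonneg _) (fun s => ?_) h1
  simpa using norm_correlation_add_sub_le hμ hf hg (s - t) t

end Continuity

/-! ### Cells of the integer lattice -/

section Lattice

/-- The inclusion of `ℤ^d` into `ℝ^d`. -/
def latticePoint (n : Fin d → ℤ) : Fin d → ℝ := fun i => n i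

/-- The half-open cube `n + [0, ε)^d` at the lattice point `n`. -/
def cell (n : Fin d → ℤ) (ε : ℝ) : Set (Fin d → ℝ) :=
  Set.univ.pi fun i => Set.Ico (n i : ℝ) (n i + ε)

theorem measurableSet_cell (n : Fin d → ℤ) (ε : ℝ) : MeasurableSet (cell n ε) :=
  MeasurableSet.univ_pi fun _ => measurableSet_Ico

theorem mem_intBox {T : ℝ} {n : Fin d → ℤ} :
    n ∈ intBox d T ↔ ∀ i, -T ≤ n i ∧ (n i : ℝ) ≤ T := by
  simp [intBox, Int.ceil_le, Int.le_floor]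

theorem card_intBox_le {T : ℝ} (hT : 0 ≤ T) : ((intBox d T).card : ℝ) ≤ (2 * T + 1) ^ d := by
  have h : ((Finset.Icc ⌈-T⌉ ⌊T⌋).card : ℝ) ≤ 2 * T + 1 := by
    have h0 : (0 : ℤ) ≤ ⌊T⌋ := Int.floor_nonneg.2 hT
    have h1 : ((⌊T⌋ + 1 + ⌊T⌋ : ℤ).toNat : ℝ) = (⌊T⌋ : ℝ) + 1 + ⌊T⌋ := by
      rw [← Int.cast_natCast, Int.toNat_of_nonneg (by omega)]
      push_cast
      ring
    rw [Int.card_Icc, Int.ceil_neg, sub_neg_eq_add, h1]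
    linarith [Int.floor_le T]
  rw [intBox, Fintype.card_piFinset]
  simpa using pow_le_pow_left₀ (Nat.cast_nonneg _) h d

theorem disjoint_cell {ε : ℝ} (hε : ε ≤ 1) {m n : Fin d → ℤ} (hmn : m ≠ n) :
    Disjoint (cell m ε) (cell n ε) := by
  refine Set.disjoint_left.2 fun t hm hn => hmn (funext fun i => ?_)
  have h1 := hm i trivial
  have h2 := hn i trivial
  have h3 : (m i : ℝ) < n i + 1 := by linarith [h1.1, h2.2]
  have h4 : (n i : ℝ) < m i + 1 := by linarith [h2.1, h1.2]
  have h5 : m i < n i + 1 := by exact_mod_cast h3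
  have h6 : n i < m i + 1 := by exact_mod_cast h4
  omega

theorem volume_real_cell (n : Fin d → ℤ) {ε : ℝ} (hε : 0 ≤ ε) :
    volume.real (cell n ε) = ε ^ d := by
  simp [Measure.real, cell, volume_pi_pi, ENNReal.toReal_ofReal hε]

theorem cell_subset_Icc {n : Fin d → ℤ} {ε T : ℝ} (hε : ε ≤ 1) (hn : n ∈ intBox d T) :
    cell n ε ⊆ Set.Icc (fun _ => -(T + 1)) (fun _ => T + 1) := by
  intro t ht
  rw [mem_intBox] at hn
  refine ⟨fun i => ?_, fun i => ?_⟩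
  · show -(T + 1) ≤ t i
    linarith [(hn i).1, (ht i trivial).1]
  · show t i ≤ T + 1
    linarith [(hn i).2, (ht i trivial).2]

theorem Icc_subset_iUnion_cell (T : ℝ) :
    Set.Icc (fun _ : Fin d => -T) (fun _ => T) ⊆ ⋃ n ∈ intBox d (T + 1), cell n 1 := by
  intro t ht
  refine Set.mem_iUnion₂.2 ⟨fun i => ⌊t i⌋, mem_intBox.2 fun i => ?_, fun i _ => ?_⟩
  · have h1 : -T ≤ t i := ht.1 i
    have h2 : t i ≤ T := ht.2 i
    constructor <;> linarith [Int.floor_le (t i), Int.lt_floor_add_one (t i)]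
  · exact ⟨Int.floor_le _, Int.lt_floor_add_one _⟩

theorem norm_le_of_mem_cell_zero {ε : ℝ} (hε : 0 ≤ ε) {s : Fin d → ℝ} (hs : s ∈ cell 0 ε) :
    ‖s‖ ≤ ε := by
  refine (pi_norm_le_iff_of_nonneg hε).2 fun i => ?_
  have h := hs i trivial
  simp only [Pi.zero_apply, Int.cast_zero, zero_add, Set.mem_Ico] at h
  rw [Real.norm_of_nonneg h.1]
  exact h.2.le

variable {F : (Fin d → ℝ) → ℝ}

theorem setIntegral_cell (F : (Fin d → ℝ) → ℝ) (n : Fin d → ℤ) (ε : ℝ) :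
    ∫ t in cell n ε, F t = ∫ s in cell 0 ε, F (s + latticePoint n) := by
  have h := (measurePreserving_add_right (volume : Measure (Fin d → ℝ))
    (latticePoint n)).setIntegral_preimage_emb (measurableEmbedding_addRight _) F (cell n ε)
  rw [← h]
  congr 2
  ext s
  simp only [cell, latticePoint, Set.mem_preimage, Set.mem_univ_pi, Set.mem_Ico, Pi.add_apply,
    Pi.zero_apply, Int.cast_zero]
  refine forall_congr' fun i => and_congr ?_ ?_ <;> constructor <;> intro h <;> linarith

theorem integrableOn_cell (hF : Continuous F) (n : Fin d → ℤ) (ε : ℝ) :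
    IntegrableOn F (cell n ε) := by
  refine (hF.integrableOn_Icc (a := fun i => (n i : ℝ)) (b := fun i => n i + ε)).mono_set ?_
  intro t ht
  exact ⟨fun i => (ht i trivial).1, fun i => (ht i trivial).2.le⟩

theorem setIntegral_Icc_le_sum_cell (hF : Continuous F) (h0 : ∀ t, 0 ≤ F t) (T : ℝ) :
    ∫ t in Set.Icc (fun _ : Fin d => -T) (fun _ => T), F t ≤
      ∑ n ∈ intBox d (T + 1), ∫ s in cell 0 1, F (s + latticePoint n) := by
  have hi : IntegrableOn F (⋃ n ∈ intBox d (T + 1), cell n 1) :=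
    (integrableOn_finset_iUnion).2 fun n _ => integrableOn_cell hF n 1
  calc _ ≤ ∫ t in ⋃ n ∈ intBox d (T + 1), cell n 1, F t :=
        setIntegral_mono_set hi (Eventually.of_forall h0)
          (Icc_subset_iUnion_cell T).eventuallyLE
    _ = ∑ n ∈ intBox d (T + 1), ∫ t in cell n 1, F t :=
        integral_biUnion_finset _ (fun n _ => measurableSet_cell n 1)
          (fun m _ n _ hmn => disjoint_cell le_rfl hmn) fun n _ => integrableOn_cell hF n 1
    _ = _ := Finset.sum_congr rfl fun n _ => setIntegral_cell F n 1

theorem sum_cell_le_setIntegral_Icc (hF : Continuous F) (h0 : ∀ t, 0 ≤ F t) {ε : ℝ} (hε : ε ≤ 1)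
    (T : ℝ) :
    ∑ n ∈ intBox d T, ∫ s in cell 0 ε, F (s + latticePoint n) ≤
      ∫ t in Set.Icc (fun _ : Fin d => -(T + 1)) (fun _ => T + 1), F t := by
  calc _ = ∑ n ∈ intBox d T, ∫ t in cell n ε, F t :=
        Finset.sum_congr rfl fun n _ => (setIntegral_cell F n ε).symm
    _ = ∫ t in ⋃ n ∈ intBox d T, cell n ε, F t :=
        (integral_biUnion_finset _ (fun n _ => measurableSet_cell n ε)
          (fun m _ n _ hmn => disjoint_cell hε hmn) fun n _ => integrableOn_cell hF n ε).symm
    _ ≤ _ := setIntegral_mono_set hF.integrableOn_Icc (Eventually.of_forall h0)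
          (Set.iUnion₂_subset fun n hn => cell_subset_Icc hε hn).eventuallyLE

end Lattice

/-! ### Comparison of the two averages -/

section Averages

variable [TopologicalSpace X] [MeasurableSpace X] {φ : Flow (Fin d → ℝ) X} {μ : Measure X}
  {f g : X → ℂ}

theorem correlation_restrictedAction (s : Fin d → ℝ) (n : Fin d → ℤ) :
    correlation (restrictedAction φ) μ f (fun x => g (φ s x)) n =
      correlation φ μ f g (s + latticePoint n) :=
  correlation_comp (φ := φ) s (latticePoint n)

theorem alphaInt_nonneg {T : ℝ} (hT : 0 ≤ T) (ψ : Flow (Fin d → ℤ) X) :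
    0 ≤ alphaInt ψ μ f g T :=
  mul_nonneg (by positivity) (Finset.sum_nonneg fun _ _ => norm_nonneg _)

theorem alphaReal_nonneg {T : ℝ} (hT : 0 ≤ T) : 0 ≤ alphaReal φ μ f g T :=
  mul_nonneg (by positivity) (integral_nonneg fun _ => norm_nonneg _)

theorem inv_mul_card_intBox_le {T : ℝ} (hT : 1 ≤ T) :
    ((2 * T) ^ d)⁻¹ * ((intBox d T).card : ℝ) ≤ 2 ^ d := by
  rw [inv_mul_le_iff₀ (by positivity), ← mul_pow]
  exact (card_intBox_le (by linarith)).trans (pow_le_pow_left₀ (by linarith) (by linarith) d)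

/-- For `T ≥ 1`, passing from the box of radius `T` to that of radius `T + 1`, which absorbs the
cubes at the boundary, costs a factor of at most `2 ^ d`. -/
theorem inv_two_mul_pow_le {T : ℝ} (hT : 1 ≤ T) :
    ((2 * T) ^ d)⁻¹ ≤ 2 ^ d * ((2 * (T + 1)) ^ d)⁻¹ := by
  rw [← div_eq_mul_inv, le_div_iff₀ (by positivity), inv_mul_le_iff₀ (by positivity), ← mul_pow]
  exact pow_le_pow_left₀ (by linarith) (by linarith) d

theorem alphaInt_restrictedAction_le (hμ : IsInvariantMeasure φ μ) (hf : MemLp f 2 μ)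
    (hg : MemLp g 2 μ) {T : ℝ} (hT : 1 ≤ T) :
    alphaInt (restrictedAction φ) μ f g T ≤ 2 ^ d * (lpNorm f 2 μ * lpNorm g 2 μ) := by
  calc alphaInt (restrictedAction φ) μ f g T
      ≤ ((2 * T) ^ d)⁻¹ * ∑ _n ∈ intBox d T, lpNorm f 2 μ * lpNorm g 2 μ := by
        refine mul_le_mul_of_nonneg_left (Finset.sum_le_sum fun n _ => ?_) (by positivity)
        exact norm_correlation_le hμ hf hg (latticePoint n)
    _ = (((2 * T) ^ d)⁻¹ * (intBox d T).card) * (lpNorm f 2 μ * lpNorm g 2 μ) := by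
        rw [Finset.sum_const, nsmul_eq_mul, mul_assoc]
    _ ≤ _ := mul_le_mul_of_nonneg_right (inv_mul_card_intBox_le hT)
        (mul_nonneg lpNorm_nonneg lpNorm_nonneg)

end Averages

section Comparison

variable [MetricSpace X] [MeasurableSpace X] [BorelSpace X] {φ : Flow (Fin d → ℝ) X}
  {μ : Measure X} [IsFiniteMeasure μ] {f g : X → ℂ}

theorem continuous_alphaInt_comp_flow (hμ : IsInvariantMeasure φ μ) (hf : MemLp f 2 μ)
    (hg : MemLp g 2 μ) (T : ℝ) :
    Continuous fun s => alphaInt (restrictedAction φ) μ f (fun x => g (φ s x)) T := by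
  simp only [alphaInt, correlation_restrictedAction]
  have h := continuous_correlation hμ hf hg
  fun_prop

/-- Writing `t = s + n` with `n ∈ ℤ^d` and `s ∈ [0, 1)^d` bounds the average over `ℝ^d` by the
mean of the averages over `ℤ^d` for the translates `g ∘ φ_s`. -/
theorem alphaReal_le_setIntegral_alphaInt (hμ : IsInvariantMeasure φ μ) (hf : MemLp f 2 μ)
    (hg : MemLp g 2 μ) {T : ℝ} (hT : 1 ≤ T) :
    alphaReal φ μ f g T ≤ 2 ^ d * ∫ s in cell (0 : Fin d → ℤ) 1,
      alphaInt (restrictedAction φ) μ f (fun x => g (φ s x)) (T + 1) := by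
  have hc : Continuous fun t => ‖correlation φ μ f g t‖ := (continuous_correlation hμ hf hg).norm
  simp only [alphaInt, correlation_restrictedAction]
  rw [integral_const_mul, integral_finsetSum]
  · rw [← mul_assoc]
    exact mul_le_mul (inv_two_mul_pow_le hT)
      (setIntegral_Icc_le_sum_cell hc (fun _ => norm_nonneg _) T)
      (integral_nonneg fun _ => norm_nonneg _) (by positivity)
  · intro n _
    exact integrableOn_cell (hc.comp (continuous_id.add continuous_const)) 0 1

/-- The value of a correlation at a lattice point is, up to its oscillation, its mean over the
cube of side `ε` at this point. -/
theorem norm_correlation_latticePoint_le (hμ : IsInvariantMeasure φ μ) (hf : MemLp f 2 μ)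
    (hg : MemLp g 2 μ) {ε ω : ℝ} (hε : 0 < ε)
    (hω : ∀ s ∈ cell (0 : Fin d → ℤ) ε, lpNorm ((fun x => g (φ s x)) - g) 2 μ ≤ ω)
    (n : Fin d → ℤ) :
    ‖correlation φ μ f g (latticePoint n)‖ ≤
      (ε ^ d)⁻¹ * (∫ s in cell (0 : Fin d → ℤ) ε, ‖correlation φ μ f g (s + latticePoint n)‖) +
        lpNorm f 2 μ * ω := by
  have hc : Continuous fun s => ‖correlation φ μ f g (s + latticePoint n)‖ :=
    ((continuous_correlation hμ hf hg).comp (continuous_id.add continuous_const)).norm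
  have h : ∫ _s in cell (0 : Fin d → ℤ) ε, ‖correlation φ μ f g (latticePoint n)‖ ≤
      ∫ s in cell (0 : Fin d → ℤ) ε,
        (‖correlation φ μ f g (s + latticePoint n)‖ + lpNorm f 2 μ * ω) := by
    refine setIntegral_mono_on (integrableOn_cell continuous_const 0 ε)
      (integrableOn_cell (hc.add continuous_const) 0 ε) (measurableSet_cell 0 ε) fun s hs => ?_
    have h1 := norm_correlation_add_sub_le hμ hf hg s (latticePoint n)
    have h2 := mul_le_mul_of_nonneg_left (hω s hs) (lpNorm_nonneg (f := f) (p := 2) (μ := μ))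
    have h3 := norm_sub_norm_le (correlation φ μ f g (latticePoint n))
      (correlation φ μ f g (s + latticePoint n))
    rw [norm_sub_rev] at h3
    linarith
  rw [integral_add (integrableOn_cell hc 0 ε) (integrableOn_cell continuous_const 0 ε),
    setIntegral_const, setIntegral_const, volume_real_cell _ hε.le, smul_eq_mul, smul_eq_mul] at h
  have hp : 0 < ε ^ d := by positivity
  rw [← mul_le_mul_iff_right₀ hp]
  refine h.trans_eq ?_
  field_simp

/-- The cubes of side `ε ≤ 1` at the lattice points are disjoint, so that the average over `ℤ^d`
is bounded by the average over `ℝ^d` up to the oscillation of the correlation. -/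
theorem alphaInt_le_alphaReal_add (hμ : IsInvariantMeasure φ μ) (hf : MemLp f 2 μ)
    (hg : MemLp g 2 μ) {ε ω T : ℝ} (hε : 0 < ε) (hε1 : ε ≤ 1) (hω0 : 0 ≤ ω) (hT : 1 ≤ T)
    (hω : ∀ s ∈ cell (0 : Fin d → ℤ) ε, lpNorm ((fun x => g (φ s x)) - g) 2 μ ≤ ω) :
    alphaInt (restrictedAction φ) μ f g T ≤
      2 ^ d * (ε ^ d)⁻¹ * alphaReal φ μ f g (T + 1) + 2 ^ d * (lpNorm f 2 μ * ω) := by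
  have hc : Continuous fun t => ‖correlation φ μ f g t‖ := (continuous_correlation hμ hf hg).norm
  calc alphaInt (restrictedAction φ) μ f g T
      ≤ ((2 * T) ^ d)⁻¹ * ∑ n ∈ intBox d T, ((ε ^ d)⁻¹ * (∫ s in cell (0 : Fin d → ℤ) ε,
          ‖correlation φ μ f g (s + latticePoint n)‖) + lpNorm f 2 μ * ω) := by
        refine mul_le_mul_of_nonneg_left (Finset.sum_le_sum fun n _ => ?_) (by positivity)
        exact norm_correlation_latticePoint_le hμ hf hg hε hω n
    _ = ((2 * T) ^ d)⁻¹ * ((ε ^ d)⁻¹ * ∑ n ∈ intBox d T, ∫ s in cell (0 : Fin d → ℤ) ε,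
          ‖correlation φ μ f g (s + latticePoint n)‖) +
          (((2 * T) ^ d)⁻¹ * (intBox d T).card) * (lpNorm f 2 μ * ω) := by
        rw [Finset.sum_add_distrib, ← Finset.mul_sum, Finset.sum_const, nsmul_eq_mul]
        ring
    _ ≤ (2 ^ d * ((2 * (T + 1)) ^ d)⁻¹) * ((ε ^ d)⁻¹ *
          ∫ t in Set.Icc (fun _ : Fin d => -(T + 1)) (fun _ => T + 1), ‖correlation φ μ f g t‖) +
          2 ^ d * (lpNorm f 2 μ * ω) := by
        refine add_le_add (mul_le_mul (inv_two_mul_pow_le hT)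
          (mul_le_mul_of_nonneg_left (sum_cell_le_setIntegral_Icc hc (fun _ => norm_nonneg _)
            hε1 T) (by positivity)) ?_ (by positivity))
          (mul_le_mul_of_nonneg_right (inv_mul_card_intBox_le hT)
            (mul_nonneg lpNorm_nonneg hω0))
        exact mul_nonneg (by positivity) (Finset.sum_nonneg fun n _ =>
          integral_nonneg fun _ => norm_nonneg _)
    _ = _ := by
        rw [alphaReal]
        ring

end Comparison

/-! ### Weak mixing -/

section WeakMixing

variable [MetricSpace X] [MeasurableSpace X] [BorelSpace X] {φ : Flow (Fin d → ℝ) X}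
  {μ : Measure X} [IsFiniteMeasure μ]

theorem IsWeakMixingInt.isWeakMixingReal (hμ : IsInvariantMeasure φ μ)
    (h : IsWeakMixingInt (restrictedAction φ) μ) : IsWeakMixingReal φ μ := by
  intro f g hf hg
  have key : Tendsto (fun T : ℝ => ∫ s in cell (0 : Fin d → ℤ) 1,
      alphaInt (restrictedAction φ) μ f (fun x => g (φ s x)) (T + 1)) atTop
      (𝓝 (∫ _s in cell (0 : Fin d → ℤ) 1, (0 : ℝ))) := by
    refine tendsto_integral_filter_of_dominated_convergence
      (fun _ => 2 ^ d * (lpNorm f 2 μ * lpNorm g 2 μ)) ?_ ?_ ?_ ?_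
    · exact Eventually.of_forall fun T =>
        (continuous_alphaInt_comp_flow hμ hf.1 hg.1 (T + 1)).aestronglyMeasurable
    · filter_upwards [eventually_ge_atTop 1] with T hT
      refine Eventually.of_forall fun s => ?_
      rw [Real.norm_of_nonneg (alphaInt_nonneg (by linarith) _),
        ← lpNorm_comp_of_measurePreserving (hμ s) hg.1]
      exact alphaInt_restrictedAction_le hμ hf.1 (hμ.memLp_comp hg.1 s) (by linarith)
    · exact integrableOn_cell continuous_const 0 1
    · exact Eventually.of_forall fun s =>
        (h f _ hf (hg.comp_flow hμ s)).comp (tendsto_atTop_add_const_right atTop 1 tendsto_id)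
  rw [integral_zero] at key
  have key2 := key.const_mul ((2 : ℝ) ^ d)
  rw [mul_zero] at key2
  refine squeeze_zero' ?_ ?_ key2
  · filter_upwards [eventually_ge_atTop 0] with T hT using alphaReal_nonneg hT
  · filter_upwards [eventually_ge_atTop 1] with T hT using
      alphaReal_le_setIntegral_alphaInt hμ hf.1 hg.1 hT

theorem IsWeakMixingReal.isWeakMixingInt (hμ : IsInvariantMeasure φ μ)
    (h : IsWeakMixingReal φ μ) : IsWeakMixingInt (restrictedAction φ) μ := by
  intro f g hf hg
  rw [Metric.tendsto_atTop']
  intro η hη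
  -- The oscillation is made small first, by the choice of `ε`; then `T` tends to infinity.
  set ω : ℝ := η / (2 * (2 ^ d * (lpNorm f 2 μ + 1))) with hω
  have hf0 : 0 ≤ lpNorm f 2 μ := lpNorm_nonneg
  have hω0 : 0 < ω := by positivity
  obtain ⟨r, hr, hr2⟩ := Metric.eventually_nhds_iff.1
    ((tendsto_lpNorm_comp_flow_sub hμ hg.1).eventually (eventually_le_nhds hω0))
  set ε : ℝ := min 1 (r / 2)
  have hε0 : 0 < ε := by positivity
  have hosc : ∀ s ∈ cell (0 : Fin d → ℤ) ε, lpNorm ((fun x => g (φ s x)) - g) 2 μ ≤ ω := by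
    intro s hs
    refine hr2 ?_
    rw [dist_zero_right]
    have h1 := norm_le_of_mem_cell_zero hε0.le hs
    have h2 : ε ≤ r / 2 := min_le_right _ _
    linarith
  have hlim := ((h f g hf hg).comp (tendsto_atTop_add_const_right atTop 1 tendsto_id)).const_mul
    (2 ^ d * (ε ^ d)⁻¹)
  rw [mul_zero] at hlim
  obtain ⟨N, hN⟩ := eventually_atTop.1 (hlim.eventually (gt_mem_nhds (half_pos hη)))
  refine ⟨max N 1, fun T hT => ?_⟩
  have hT1 : 1 ≤ T := (le_max_right _ _).trans hT.le
  rw [Real.dist_eq, sub_zero, abs_of_nonneg (alphaInt_nonneg (by linarith) _)]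
  have h1 := alphaInt_le_alphaReal_add hμ hf.1 hg.1 hε0 (min_le_left _ _) hω0.le hT1 hosc
  have h2 : 2 ^ d * (ε ^ d)⁻¹ * alphaReal φ μ f g (T + 1) < η / 2 :=
    hN T ((le_max_left _ _).trans hT.le)
  have h3 : 2 ^ d * (lpNorm f 2 μ * ω) ≤ η / 2 := by
    have e : 2 ^ d * ((lpNorm f 2 μ + 1) * ω) = η / 2 := by
      rw [hω]
      field_simp
    rw [← e]
    gcongr
    linarith
  linarith

end WeakMixing

/-! ### Polynomial weak mixing -/

theorem lpNorm_le_of_bound [MeasurableSpace X] {μ : Measure X} [IsFiniteMeasure μ]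
    {f : X → ℂ} {M : ℝ} (hM : 0 ≤ M)
    (hf : AEStronglyMeasurable f μ) (h : ∀ x, ‖f x‖ ≤ M) :
    lpNorm f 2 μ ≤ μ.real Set.univ ^ (2 : ℝ)⁻¹ * M := by
  have h1 := eLpNorm_le_of_ae_bound (μ := μ) (p := 2) (Eventually.of_forall h)
  rw [← toReal_eLpNorm hf]
  have h2 : μ Set.univ ^ (2 : ℝ≥0∞).toReal⁻¹ ≠ ⊤ :=
    ENNReal.rpow_ne_top_of_nonneg (by norm_num) (measure_ne_top _ _)
  refine (ENNReal.toReal_mono (ENNReal.mul_ne_top h2 ENNReal.ofReal_ne_top) h1).trans_eq ?_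
  rw [ENNReal.toReal_mul, ENNReal.toReal_ofReal hM, ← ENNReal.toReal_rpow]
  rfl

theorem norm_le_of_holderSpaceNorm_le [MetricSpace X] {ρ : ℝ≥0} {f : X → ℂ} {M : ℝ}
    (hM : 0 ≤ M) (h : holderSpaceNorm ρ f ≤ ENNReal.ofReal M) (x : X) : ‖f x‖ ≤ M := by
  have h1 : ‖f x‖ₑ ≤ ENNReal.ofReal M := (le_iSup (fun x => ‖f x‖ₑ) x).trans
    ((le_add_of_nonneg_right zero_le).trans h)
  rwa [← ofReal_norm, ENNReal.ofReal_le_ofReal_iff hM] at h1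

theorem norm_sub_le_of_holderSpaceNorm_le [MetricSpace X] {ρ : ℝ≥0} {f : X → ℂ} {M : ℝ}
    (hM : 0 ≤ M) (h : holderSpaceNorm ρ f ≤ ENNReal.ofReal M) (x y : X) :
    ‖f x - f y‖ ≤ M * dist x y ^ (ρ : ℝ) := by
  have h1 : eHolderNorm ρ f ≤ ENNReal.ofReal M := (le_add_of_nonneg_left zero_le).trans h
  have h2 : MemHolder ρ f := eHolderNorm_lt_top.1 (h1.trans_lt ENNReal.ofReal_lt_top)
  have h3 : (nnHolderNorm ρ f : ℝ) ≤ M := by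
    rw [← h2.coe_nnHolderNorm_eq_eHolderNorm, ENNReal.ofReal, ENNReal.coe_le_coe] at h1
    exact (Real.le_toNNReal_iff_coe_le hM).1 h1
  have h4 := h2.holderWith.dist_le x y
  rw [dist_eq_norm] at h4
  exact h4.trans (mul_le_mul_of_nonneg_right h3 (by positivity))

section Polynomial

variable [MetricSpace X] [MeasurableSpace X] {φ : Flow (Fin d → ℝ) X}
  {μ : Measure X} [IsFiniteMeasure μ]

/-- A Hölder function composed with a Hölder continuous action is Hölder continuous in time, with
values in `L²`. -/
theorem lpNorm_comp_flow_sub_le {ρ : ℝ≥0} {σ A M ε : ℝ} {g : X → ℂ} {s : Fin d → ℝ} (hσ : 0 < σ)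
    (hA : 0 ≤ A) (hM : 0 ≤ M) (hε : 0 ≤ ε) (hμ : IsInvariantMeasure φ μ) (hg : MemLp g 2 μ)
    (hgM : holderSpaceNorm ρ g ≤ ENNReal.ofReal M)
    (hφ : ∀ x, dist (φ s x) (φ 0 x) ≤ A * dist s 0 ^ σ) (hs : ‖s‖ ≤ ε) :
    lpNorm ((fun x => g (φ s x)) - g) 2 μ ≤
      μ.real Set.univ ^ (2 : ℝ)⁻¹ * (M * (A ^ (ρ : ℝ) * ε ^ (σ * ρ))) := by
  refine lpNorm_le_of_bound (by positivity) ((hμ.memLp_comp hg s).sub hg).1 fun x => ?_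
  refine (norm_sub_le_of_holderSpaceNorm_le hM hgM _ _).trans ?_
  gcongr
  have h1 : dist (φ s x) x ≤ A * ε ^ σ := by
    have h2 := hφ x
    rw [φ.map_zero_apply, dist_zero_right] at h2
    refine h2.trans ?_
    gcongr
  rw [Real.rpow_mul hε, ← Real.mul_rpow hA (by positivity)]
  gcongr

variable [BorelSpace X]

theorem IsPolyWeakMixingInt.isPolyWeakMixingReal (hμ : IsInvariantMeasure φ μ)
    {B : BanachFunctionAlgebra μ} (hB : ConditionN2 φ B)
    (h : IsPolyWeakMixingInt (restrictedAction φ) B) : IsPolyWeakMixingReal φ B := by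
  obtain ⟨δ, hδ, C, hC⟩ := h
  obtain ⟨K, hK, C₂, hC₂⟩ := hB
  refine ⟨δ, hδ, 2 ^ d * (|C| * |C₂| * 2 ^ K), fun f g hf hg T hT => ?_⟩
  have hT0 : 0 < T := by linarith
  have hf0 : 0 ≤ B.normB f := apply_nonneg _ _
  have hg0 : 0 ≤ B.normB g := apply_nonneg _ _
  refine (alphaReal_le_setIntegral_alphaInt hμ hf.1 hg.1 hT).trans ?_
  rw [mul_assoc (2 ^ d), mul_assoc (2 ^ d), mul_assoc (2 ^ d)]
  gcongr
  have hb : ∀ s ∈ cell (0 : Fin d → ℤ) 1,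
      ‖alphaInt (restrictedAction φ) μ f (fun x => (g : X → ℂ) (φ s x)) (T + 1)‖ ≤
        |C| * |C₂| * 2 ^ K * B.normB f * B.normB g * T ^ (-δ) := by
    intro s hs
    rw [Real.norm_of_nonneg (alphaInt_nonneg (by linarith) _)]
    obtain ⟨hm, hn⟩ := hC₂ s g
    have hs1 : 1 + ‖s‖ ≤ 2 := by linarith [norm_le_of_mem_cell_zero zero_le_one hs]
    have hn' : B.normB ⟨fun x => (g : X → ℂ) (φ s x), hm⟩ ≤ |C₂| * B.normB g * 2 ^ K := by
      refine hn.trans ?_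
      gcongr
      exact le_abs_self _
    have hn0 : 0 ≤ B.normB ⟨fun x => (g : X → ℂ) (φ s x), hm⟩ := apply_nonneg _ _
    calc _ ≤ C * B.normB f * B.normB ⟨fun x => (g : X → ℂ) (φ s x), hm⟩ * (T + 1) ^ (-δ) :=
          hC f ⟨_, hm⟩ hf (hg.comp_flow hμ s) (T + 1) (by linarith)
      _ ≤ |C| * B.normB f * (|C₂| * B.normB g * 2 ^ K) * T ^ (-δ) := by
          have h1 : (T + 1) ^ (-δ) ≤ T ^ (-δ) :=
            Real.rpow_le_rpow_of_nonpos hT0 (by linarith) (by linarith)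
          gcongr
          exact le_abs_self _
      _ = _ := by ring
  have hfin : volume (cell (0 : Fin d → ℤ) 1) < ⊤ := by
    simp [cell, volume_pi_pi]
  have h1 := norm_setIntegral_le_of_norm_le_const hfin hb
  rw [volume_real_cell _ zero_le_one, one_pow, mul_one] at h1
  refine (Real.le_norm_self _).trans (h1.trans_eq ?_)
  ring

theorem IsPolyWeakMixingReal.isPolyWeakMixingInt (hμ : IsInvariantMeasure φ μ)
    {B : BanachFunctionAlgebra μ} (hφ : IsHolderAction φ) (hB : ConditionN1 B)
    (h : IsPolyWeakMixingReal φ B) : IsPolyWeakMixingInt (restrictedAction φ) B := by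
  obtain ⟨δ, hδ, C, hC⟩ := h
  obtain ⟨ρ, hρ, C₁, hC₁⟩ := hB
  obtain ⟨σ, hσ, A, hA⟩ := hφ
  have hρ' : (0 : ℝ) < ρ := hρ
  set m : ℝ := μ.real Set.univ ^ (2 : ℝ)⁻¹
  have hm0 : 0 ≤ m := by positivity
  -- For `ε = T ^ (-κ)` the averages contribute `ε⁻ᵈ T ^ (-δ) = T ^ (-κ)`, and the oscillation
  -- contributes `ε ^ (σ ρ) = T ^ (-κ σ ρ)`.
  set κ : ℝ := δ / (d + 1) with hκ
  have hκ0 : 0 < κ := by positivity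
  have hκδ : κ * d + κ = δ := by
    rw [hκ]
    field_simp
  refine ⟨κ * min 1 (σ * ρ), by positivity,
    2 ^ d * |C| + 2 ^ d * (m * |C₁| * (m * (|C₁| * |A| ^ (ρ : ℝ)))), fun f g hf hg T hT => ?_⟩
  have hT0 : 0 < T := by linarith
  have hf0 : 0 ≤ B.normB f := apply_nonneg _ _
  have hg0 : 0 ≤ B.normB g := apply_nonneg _ _
  have hH : ∀ u : B.carrier,
      holderSpaceNorm ρ (u : X → ℂ) ≤ ENNReal.ofReal (|C₁| * B.normB u) := fun u =>
    (hC₁ u).trans (ENNReal.ofReal_le_ofReal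
      (mul_le_mul_of_nonneg_right (le_abs_self _) (apply_nonneg _ _)))
  set ε : ℝ := T ^ (-κ) with hε
  have hε0 : 0 < ε := by positivity
  have hε1 : ε ≤ 1 := Real.rpow_le_one_of_one_le_of_nonpos hT (by linarith)
  have hosc : ∀ s ∈ cell (0 : Fin d → ℤ) ε,
      lpNorm ((fun x => (g : X → ℂ) (φ s x)) - (g : X → ℂ)) 2 μ ≤
        m * (|C₁| * B.normB g * (|A| ^ (ρ : ℝ) * ε ^ (σ * ρ))) := by
    intro s hs
    have hs1 := norm_le_of_mem_cell_zero hε0.le hs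
    refine lpNorm_comp_flow_sub_le hσ (abs_nonneg A) (by positivity) hε0.le hμ hg.1 (hH g)
      (fun x => ?_) hs1
    refine (hA s 0 x (by rw [dist_zero_right]; linarith)).trans ?_
    gcongr
    exact le_abs_self _
  have hfn : lpNorm (f : X → ℂ) 2 μ ≤ m * (|C₁| * B.normB f) :=
    lpNorm_le_of_bound (by positivity) hf.1.1
      (norm_le_of_holderSpaceNorm_le (by positivity) (hH f))
  have hα : alphaReal φ μ f g (T + 1) ≤ |C| * B.normB f * B.normB g * T ^ (-δ) := by
    refine (hC f g hf hg (T + 1) (by linarith)).trans ?_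
    have h1 : (T + 1) ^ (-δ) ≤ T ^ (-δ) :=
      Real.rpow_le_rpow_of_nonpos hT0 (by linarith) (by linarith)
    gcongr
    exact le_abs_self _
  have e1 : (ε ^ d)⁻¹ * T ^ (-δ) ≤ T ^ (-(κ * min 1 (σ * ρ))) := by
    rw [hε, ← Real.rpow_mul_natCast hT0.le, ← Real.rpow_neg hT0.le, ← Real.rpow_add hT0]
    refine Real.rpow_le_rpow_of_exponent_le hT ?_
    have := mul_le_mul_of_nonneg_left (min_le_left 1 (σ * ρ)) hκ0.le
    linarith
  have e2 : ε ^ (σ * ρ) ≤ T ^ (-(κ * min 1 (σ * ρ))) := by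
    rw [hε, ← Real.rpow_mul hT0.le]
    refine Real.rpow_le_rpow_of_exponent_le hT ?_
    have := mul_le_mul_of_nonneg_left (min_le_right 1 (σ * ρ)) hκ0.le
    linarith
  calc alphaInt (restrictedAction φ) μ f g T
      ≤ 2 ^ d * (ε ^ d)⁻¹ * alphaReal φ μ f g (T + 1) + 2 ^ d * (lpNorm (f : X → ℂ) 2 μ *
          (m * (|C₁| * B.normB g * (|A| ^ (ρ : ℝ) * ε ^ (σ * ρ))))) :=
        alphaInt_le_alphaReal_add hμ hf.1 hg.1 hε0 hε1 (by positivity) hT hosc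
    _ ≤ 2 ^ d * (ε ^ d)⁻¹ * (|C| * B.normB f * B.normB g * T ^ (-δ)) +
          2 ^ d * (m * (|C₁| * B.normB f) *
            (m * (|C₁| * B.normB g * (|A| ^ (ρ : ℝ) * ε ^ (σ * ρ))))) := by
        gcongr
    _ = 2 ^ d * |C| * B.normB f * B.normB g * ((ε ^ d)⁻¹ * T ^ (-δ)) +
          2 ^ d * (m * |C₁| * (m * (|C₁| * |A| ^ (ρ : ℝ)))) * B.normB f * B.normB g *
            ε ^ (σ * ρ) := by
        ring
    _ ≤ 2 ^ d * |C| * B.normB f * B.normB g * T ^ (-(κ * min 1 (σ * ρ))) +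
          2 ^ d * (m * |C₁| * (m * (|C₁| * |A| ^ (ρ : ℝ)))) * B.normB f * B.normB g *
            T ^ (-(κ * min 1 (σ * ρ))) := by
        gcongr
    _ = _ := by ring

end Polynomial

end WeakMixing

theorem mainTheorem4 {X : Type*} [MetricSpace X] [MeasurableSpace X] [BorelSpace X] {d : ℕ}
    (φ : Flow (Fin d → ℝ) X) (μ : Measure X) [IsFiniteMeasure μ]
    (hμ : WeakMixing.IsInvariantMeasure φ μ) :
    (WeakMixing.IsWeakMixingReal φ μ ↔
      WeakMixing.IsWeakMixingInt (WeakMixing.restrictedAction φ) μ) ∧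
    ∀ B : WeakMixing.BanachFunctionAlgebra μ,
      WeakMixing.IsHolderAction φ → WeakMixing.ConditionN φ B →
        (WeakMixing.IsPolyWeakMixingReal φ B ↔
          WeakMixing.IsPolyWeakMixingInt (WeakMixing.restrictedAction φ) B) := by
  refine ⟨⟨fun h => h.isWeakMixingInt hμ, fun h => h.isWeakMixingReal hμ⟩, fun B hφ hN => ?_⟩
  exact ⟨fun h => h.isPolyWeakMixingInt hμ hφ hN.1, fun h => h.isPolyWeakMixingReal hμ hN.2⟩
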